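/- An unlayered algebraic branching program (ABP) over a field $\mathbb F$ in the variables $x_1,\dots,x_n$ is a finite directed acyclic graph with a designated start vertex and a designated end vertex, in which every edge is labeled by a polynomial in $\mathbb F[x_1,\dots,x_n]$. It computes the sum, over all directed paths from the start vertex to the end vertex, of the product of the labels of the edges on the path. Its size is its number of edges. Theorem. There is an absolute constant $c>0$ such that the following holds. Let $\Delta:\mathbb N\to\mathbb N$ be a function with $\Delta(n)=n^{o(1)}$ as $n\to\infty$. Then there is an $N$, depending only on the function $\Delta$, such that for every $n\ge N$ and every field $\mathbb F$ with $\operatorname{char}(\mathbb F)\nmid n$, every unlayered ABP over $\mathbb F$ all of whose edge labels have degree at most $\Delta(n)$ and which computes $\sum_{i=1}^n x_i^n$ has size at least $$c\cdot\frac{n\log_2 n}{\log_2\log_2 n+\log_2\Delta(n)}.$$ In short, the number of edges is $\Omega\bigl(n\log n/(\log\log n+\log\Delta)\bigr)$. -/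

import Mathlib

open Filter Topology

/-- `IsDiPath src tgt u l v`: in the directed (multi)graph with edge set `E`, tail map `src` and
head map `tgt`, the list of edges `l` is a directed path from the vertex `u` to the vertex `v`.
The empty list is the path of length `0` from a vertex to itself. -/
def IsDiPath {V E : Type*} (src tgt : E → V) : V → List E → V → Prop
  | u, [], v => u = v
  | u, e :: l, v => src e = u ∧ IsDiPath src tgt (tgt e) l v

/-- An unlayered algebraic branching program over `F` in the variables `x_1, …, x_n`, with vertex
set `V` and edge set `E`: a directed acyclic graph, with a start vertex and an end vertex, each of
whose edges is labeled by a polynomial. -/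
structure UnlayeredABP (F : Type*) [CommSemiring F] (n : ℕ) (V E : Type*) where
  /-- the tail of an edge -/
  src : E → V
  /-- the head of an edge -/
  tgt : E → V
  /-- the label of an edge -/
  label : E → MvPolynomial (Fin n) F
  /-- the start vertex -/
  start : V
  /-- the end vertex -/
  finish : V
  /-- there is no directed cycle: a closed directed path has length `0` -/
  acyclic : ∀ (v : V) (l : List E), IsDiPath src tgt v l v → l = []

namespace UnlayeredABP

variable {F : Type*} [CommSemiring F] {n : ℕ} {V E : Type*}

/-- `l` is a path of the program from its start vertex to its end vertex. -/
def IsComputationPath (A : UnlayeredABP F n V E) (l : List E) : Prop :=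
  IsDiPath A.src A.tgt A.start l A.finish

/-- The weight of a path is the product of the labels of its edges. -/
noncomputable def weight (A : UnlayeredABP F n V E) (l : List E) : MvPolynomial (Fin n) F :=
  (l.map A.label).prod

/-- The polynomial computed by the program: the sum of the weights of all paths from the start
vertex to the end vertex. (There are finitely many of them if there are finitely many edges, see
`finite_computationPaths`.) -/
noncomputable def computedPolynomial (A : UnlayeredABP F n V E) : MvPolynomial (Fin n) F :=
  ∑ᶠ l ∈ {l : List E | A.IsComputationPath l}, A.weight l

/-- All edge labels have (total) degree at most `Δ`. -/
def LabelsDegreeLE (A : UnlayeredABP F n V E) (Δ : ℕ) : Prop :=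
  ∀ e : E, (A.label e).totalDegree ≤ Δ

/-- The size of an unlayered program: its number of edges. -/
noncomputable def size (_A : UnlayeredABP F n V E) : ℕ := Nat.card E

end UnlayeredABP

theorem IsDiPath.split {V E : Type*} {src tgt : E → V} {e : E} {c : List E} :
    ∀ {b : List E} {u v : V}, IsDiPath src tgt u (b ++ e :: c) v → IsDiPath src tgt u b (src e)
  | [], _, _, h => h.1.symm
  | _ :: _, _, _, h => ⟨h.1, IsDiPath.split h.2⟩

theorem UnlayeredABP.nodup_of_isDiPath {F : Type*} [CommSemiring F] {n : ℕ} {V E : Type*}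
    (A : UnlayeredABP F n V E) :
    ∀ {l : List E} {u v : V}, IsDiPath A.src A.tgt u l v → l.Nodup
  | [], _, _, _ => List.nodup_nil
  | e :: l, u, v, h => by
    refine List.nodup_cons.2 ⟨fun he => ?_, A.nodup_of_isDiPath h.2⟩
    obtain ⟨b, c, rfl⟩ := List.append_of_mem he
    have := A.acyclic (A.src e) (e :: b) ⟨rfl, IsDiPath.split h.2⟩
    simp at this

theorem UnlayeredABP.finite_computationPaths {F : Type*} [CommSemiring F] {n : ℕ} {V E : Type*}
    [Finite E] (A : UnlayeredABP F n V E) : {l : List E | A.IsComputationPath l}.Finite := by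
  haveI := Fintype.ofFinite E
  refine (List.finite_length_le E (Fintype.card E)).subset fun l hl => ?_
  exact (A.nodup_of_isDiPath hl).length_le_card

/-- `Δ(n) = n^{o(1)}`, as an upper bound: `Δ(n) ≤ n^{ε(n)}` for all large `n`, where
`ε(n) → 0` as `n → ∞`. -/
def IsSubpolynomial (Δ : ℕ → ℕ) : Prop :=
  ∃ ε : ℕ → ℝ, Tendsto ε atTop (𝓝 0) ∧ ∀ᶠ n : ℕ in atTop, (Δ n : ℝ) ≤ (n : ℝ) ^ ε n

/-! Valiant's depth reduction is combined with Krull's height theorem. An acyclic graph with `m < 2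
^ k` edges has a vertex ranking below `2 ^ k`, and deleting a set `T` of at most `m * t / k` edges
leaves a ranking below `2 ^ (k - t)` (`exists_edge_removal`). For `t` about `log log n + log Δ`, the
remaining path sums have degree below `n`. Each deleted edge costs one product of two polynomials,
which can be shifted to have zero constant term (`pathForm_insert`). Hence `∑ X i ^ n = ∑ j ∈ T, P j
* Q j + R` with `deg R < n`. Modulo the ideal of all `P j`, `Q j`, differentiating expresses `X i ^
(n - 1)` through lower degree, so the quotient is finite-dimensional. As the ideal vanishes at the
origin, a minimal prime over it is the maximal ideal there, of height at least `n`, and Krull gives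
`n ≤ 2 * T.card` (`le_two_mul_card_of_sum_pow_eq`). Therefore `m ≥ n * k / (2 * t)`. -/

namespace MvPolynomial

variable {F : Type*} [Field F] {n : ℕ}

/-! ### Commutative algebra: products needed for a power sum. -/

/-- The substitution sending the first `k` variables to zero. -/
noncomputable def killFirst (F : Type*) [Field F] (n k : ℕ) :
    MvPolynomial (Fin n) F →ₐ[F] MvPolynomial (Fin n) F :=
  aeval fun i => if (i : ℕ) < k then 0 else X i

theorem killFirst_X (k : ℕ) (i : Fin n) :
    killFirst F n k (X i) = if (i : ℕ) < k then 0 else X i := by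
  simp [killFirst]

/-- The kernels for `0, 1, …, k` form a strictly increasing chain of primes. -/
theorem le_height_ker_killFirst (k : ℕ) (hk : k ≤ n) :
    (k : ℕ∞) ≤ (RingHom.ker (killFirst F n k)).height := by
  induction k with
  | zero => simp
  | succ k ih =>
    have hprime (j : ℕ) : (RingHom.ker (killFirst F n j)).IsPrime := RingHom.ker_isPrime _
    have hcomp : (killFirst F n (k + 1)).comp (killFirst F n k) = killFirst F n (k + 1) := by
      ext i : 1
      by_cases h : (i : ℕ) < k
      · simp [killFirst_X, h, show (i : ℕ) < k + 1 by omega]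
      · simp [killFirst_X, h]
    have hlt : RingHom.ker (killFirst F n k) < RingHom.ker (killFirst F n (k + 1)) := by
      refine SetLike.lt_iff_le_and_exists.2 ⟨fun f hf => ?_, X ⟨k, hk⟩, ?_, ?_⟩
      · rw [RingHom.mem_ker] at hf ⊢
        rw [← hcomp, AlgHom.comp_apply, hf, map_zero]
      · simp [RingHom.mem_ker, killFirst_X]
      · simp [RingHom.mem_ker, killFirst_X]
    have := hprime k
    have := hprime (k + 1)
    have h := Ideal.height_add_one_le_of_lt_of_isPrime hlt
    push_cast
    exact (add_le_add_left (ih (by omega)) 1).trans h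

theorem le_height_ker_constantCoeff :
    (n : ℕ∞) ≤ (RingHom.ker (constantCoeff : MvPolynomial (Fin n) F →+* F)).height := by
  refine (le_height_ker_killFirst n le_rfl).trans (Ideal.height_mono fun f hf => ?_)
  rw [RingHom.mem_ker] at hf ⊢
  have hcomp : (constantCoeff : MvPolynomial (Fin n) F →+* F).comp
      (killFirst F n n : MvPolynomial (Fin n) F →+* MvPolynomial (Fin n) F) = constantCoeff := by
    ext i <;> simp [killFirst]
  rw [← hcomp, RingHom.comp_apply, RingHom.coe_coe, hf, map_zero]

/-- If every variable satisfies, modulo `I`, an equation `X i ^ d = g` with `g` of degree less than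
`d`, then the quotient by `I` is finite-dimensional. -/
theorem finite_quotient_of_pow_sub_mem {σ : Type*} [Finite σ] {I : Ideal (MvPolynomial σ F)}
    {d : ℕ}
    (h : ∀ i, ∃ g : MvPolynomial σ F, X i ^ d - g ∈ I ∧ ∀ m ∈ g.support, m.degree < d) :
    Module.Finite F (MvPolynomial σ F ⧸ I) := by
  classical
  have := Fintype.ofFinite σ
  -- Any monomial outside this finite box has an exponent above `d`, and rewriting `X i ^ d` as `g`
  -- strictly lowers its degree.
  let S : Set (σ →₀ ℕ) := Set.Iic (Finsupp.equivFunOnFinite.symm fun _ => d)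
  let mk := (Ideal.Quotient.mkₐ F I).toLinearMap
  let W : Submodule F (MvPolynomial σ F ⧸ I) :=
    Submodule.span F ((fun m => mk (monomial m 1)) '' S)
  have key : ∀ (N : ℕ) (m : σ →₀ ℕ), m.degree = N → mk (monomial m 1) ∈ W := by
    intro N
    induction N using Nat.strong_induction_on with
    | _ N ih =>
      intro m hm
      by_cases hmS : m ∈ S
      · exact Submodule.subset_span ⟨m, hmS, rfl⟩
      obtain ⟨i, hi⟩ : ∃ i, d < m i := by
        by_contra! hcon
        exact hmS fun i => by simpa using hcon i
      obtain ⟨g, hgI, hg⟩ := h i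
      have hle : Finsupp.single i d ≤ m := by
        rw [Finsupp.single_le_iff]; exact hi.le
      set m' := m - Finsupp.single i d with hm'
      have hsum : m' + Finsupp.single i d = m := tsub_add_cancel_of_le hle
      have hmon : (monomial m (1 : F)) = monomial m' 1 * X i ^ d := by
        rw [X_pow_eq_monomial, monomial_mul, hsum, one_mul]
      have hred : mk (monomial m 1) = mk (monomial m' 1 * g) := by
        change Ideal.Quotient.mk I _ = Ideal.Quotient.mk I _
        rw [Ideal.Quotient.eq, hmon, ← mul_sub]
        exact I.mul_mem_left _ hgI
      have hexp : monomial m' (1 : F) * g = ∑ s ∈ g.support, coeff s g • monomial (m' + s) 1 := by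
        conv_lhs => rw [g.as_sum, Finset.mul_sum]
        refine Finset.sum_congr rfl fun s _ => ?_
        rw [monomial_mul, smul_monomial, one_mul, smul_eq_mul, mul_one]
      rw [hred, hexp, map_sum]
      refine Submodule.sum_mem _ fun s hs => ?_
      rw [map_smul]
      refine Submodule.smul_mem _ _ (ih _ ?_ _ rfl)
      rw [← hm, ← hsum, map_add, map_add, Finsupp.degree_single]
      have := hg s hs
      omega
  have htop : W = ⊤ := by
    refine Submodule.eq_top_iff'.2 fun x => ?_
    obtain ⟨f, rfl⟩ := Ideal.Quotient.mk_surjective x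
    change mk f ∈ W
    rw [f.as_sum, map_sum]
    refine Submodule.sum_mem _ fun s _ => ?_
    rw [← mul_one (coeff s f), ← smul_eq_mul, ← smul_monomial, map_smul]
    exact Submodule.smul_mem _ _ (key _ _ rfl)
  exact ⟨htop ▸ Submodule.fg_span ((Set.finite_Iic _).image _)⟩

/-- A power sum in `n` variables of degree `n` is not, up to lower degree terms, a sum of fewer than
`n / 2` products of polynomials without constant term. -/
theorem le_two_mul_card_of_sum_pow_eq {ι : Type*} (T : Finset ι)
    (P Q : ι → MvPolynomial (Fin n) F) (R : MvPolynomial (Fin n) F)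
    (hn : (n : F) ≠ 0) (hP : ∀ j ∈ T, constantCoeff (P j) = 0)
    (hQ : ∀ j ∈ T, constantCoeff (Q j) = 0) (hR : R.totalDegree < n)
    (h : ∑ i : Fin n, (X i : MvPolynomial (Fin n) F) ^ n = ∑ j ∈ T, P j * Q j + R) :
    n ≤ 2 * T.card := by
  classical
  let G : Finset (MvPolynomial (Fin n) F) := T.image P ∪ T.image Q
  have hPG : ∀ j ∈ T, P j ∈ G := fun j hj =>
    Finset.mem_union_left _ (Finset.mem_image_of_mem _ hj)
  have hQG : ∀ j ∈ T, Q j ∈ G := fun j hj =>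
    Finset.mem_union_right _ (Finset.mem_image_of_mem _ hj)
  have hGle : Ideal.span (G : Set (MvPolynomial (Fin n) F)) ≤
      RingHom.ker (constantCoeff : MvPolynomial (Fin n) F →+* F) := by
    rw [Ideal.span_le]
    intro f hf
    rw [SetLike.mem_coe, RingHom.mem_ker]
    rcases Finset.mem_union.1 (Finset.mem_coe.1 hf) with hf | hf
    · obtain ⟨j, hj, rfl⟩ := Finset.mem_image.1 hf
      exact hP j hj
    · obtain ⟨j, hj, rfl⟩ := Finset.mem_image.1 hf
      exact hQ j hj
  have hker : (RingHom.ker (constantCoeff : MvPolynomial (Fin n) F →+* F)).IsPrime :=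
    RingHom.ker_isPrime _
  obtain ⟨p, hp, hple⟩ := Ideal.exists_minimalPrimes_le hGle
  have hpp : p.IsPrime := hp.isPrime
  have hGp : ∀ f ∈ G, f ∈ p := fun f hf => hp.1.2 (Ideal.subset_span hf)
  have hfin : Module.Finite F (MvPolynomial (Fin n) F ⧸ p) := by
    -- Applying `pderiv i` to `h` gives `n * X i ^ (n - 1) = pderiv i R` modulo `p`, by the Leibniz
    -- rule; here `n` must be invertible in `F`.
    refine finite_quotient_of_pow_sub_mem (d := n - 1) fun i =>
      ⟨C (n : F)⁻¹ * pderiv i R, ?_, fun m hm => ?_⟩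
    · have hd := congrArg (pderiv i) h
      rw [map_add, map_sum, map_sum, Finset.sum_eq_single i (fun j _ hj => by
        rw [pderiv_pow, pderiv_X_of_ne hj, mul_zero]) (by simp), pderiv_pow, pderiv_X_self,
        mul_one] at hd
      have hmem : ∑ j ∈ T, pderiv i (P j * Q j) ∈ p := by
        refine Ideal.sum_mem _ fun j hj => ?_
        rw [pderiv_mul]
        exact add_mem (p.mul_mem_left _ (hGp _ (hQG j hj))) (p.mul_mem_right _ (hGp _ (hPG j hj)))
      rw [← sub_eq_of_eq_add hd] at hmem
      have hC : (C (n : F)⁻¹ : MvPolynomial (Fin n) F) * (n : MvPolynomial (Fin n) F) = 1 := by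
        rw [← map_natCast (C : F →+* MvPolynomial (Fin n) F), ← map_mul, inv_mul_cancel₀ hn,
          map_one]
      have := p.mul_mem_left (C (n : F)⁻¹) hmem
      rwa [mul_sub, ← mul_assoc, hC, one_mul] at this
    · rw [mem_support_iff, coeff_C_mul, coeff_pderiv] at hm
      have hc : m + Finsupp.single i 1 ∈ R.support := by
        rw [mem_support_iff]
        intro h0
        simp [h0] at hm
      have := le_totalDegree hc
      change (m + Finsupp.single i 1).degree ≤ _ at this
      rw [map_add, Finsupp.degree_single] at this
      omega
  -- A finite-dimensional domain is a field, so `p` is maximal and equals the ideal of the origin.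
  have hart : IsArtinianRing (MvPolynomial (Fin n) F ⧸ p) := IsArtinianRing.of_finite F _
  have hmax : p.IsMaximal := Ideal.Quotient.maximal_of_isField _ (IsArtinianRing.isField_of_isDomain _)
  have hpeq := hmax.eq_of_le hker.ne_top hple
  have h1 := le_height_ker_constantCoeff (F := F) (n := n)
  rw [← hpeq] at h1
  have h2 := h1.trans (Ideal.height_le_card_of_mem_minimalPrimes_span_finset hp)
  have h3 : n ≤ G.card := by exact_mod_cast h2
  have h4 := Finset.card_union_le (T.image P) (T.image Q)
  have h5 := Finset.card_image_le (s := T) (f := P)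
  have h6 := Finset.card_image_le (s := T) (f := Q)
  change n ≤ (T.image P ∪ T.image Q).card at h3
  omega

end MvPolynomial

/-! ### Path sums in an acyclic graph. -/

section PathSum

open scoped Classical in
/-- The weighted adjacency matrix of the graph with edge set `S`. -/
noncomputable def edgeMatrix {V E R : Type*} [CommRing R] (src tgt : E → V)
    (w : E → R) (S : Finset E) : Matrix V V R :=
  ∑ e ∈ S, Matrix.single (src e) (tgt e) (w e)

open scoped Classical in
/-- The matrix of weighted sums over paths with fewer than `K` edges. -/
noncomputable def pathMatrix {V E R : Type*} [Fintype V] [CommRing R] (src tgt : E → V)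
    (w : E → R) (K : ℕ) (S : Finset E) : Matrix V V R :=
  ∑ k ∈ Finset.range K, edgeMatrix src tgt w S ^ k

open scoped Classical

variable {V E R : Type*} [Fintype V] [CommRing R] {src tgt : E → V} {w : E → R}
  {S : Finset E} {r : V → ℕ} {K : ℕ}

theorem edgeMatrix_mul_apply (M : Matrix V V R) (u v : V) :
    (edgeMatrix src tgt w S * M) u v = ∑ e ∈ S, if src e = u then w e * M (tgt e) v else 0 := by
  rw [edgeMatrix, Finset.sum_mul, Matrix.sum_apply]
  refine Finset.sum_congr rfl fun e _ => ?_
  split_ifs with h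
  · subst h
    rw [Matrix.single_mul_apply_same]
  · rw [Matrix.single_mul_apply_of_ne _ _ _ _ _ (Ne.symm h)]

theorem edgeMatrix_pow_succ_apply (k : ℕ) (u v : V) :
    (edgeMatrix src tgt w S ^ (k + 1)) u v =
      ∑ e ∈ S, if src e = u then w e * (edgeMatrix src tgt w S ^ k) (tgt e) v else 0 := by
  rw [pow_succ', edgeMatrix_mul_apply]

/-- Each edge raises the rank by at least one, so `k` edges raise it by at least `k`. -/
theorem edgeMatrix_pow_apply_eq_zero (hr : ∀ e ∈ S, r (src e) < r (tgt e)) (k : ℕ) {u v : V}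
    (h : r v < r u + k) : (edgeMatrix src tgt w S ^ k) u v = 0 := by
  induction k generalizing u with
  | zero =>
    have : u ≠ v := by rintro rfl; omega
    simp [this]
  | succ k ih =>
    rw [edgeMatrix_pow_succ_apply]
    refine Finset.sum_eq_zero fun e he => ?_
    split_ifs with hu
    · have := hr e he
      rw [ih (by rw [← hu] at h; omega), mul_zero]
    · rfl

theorem edgeMatrix_pow_eq_zero (hr : ∀ e ∈ S, r (src e) < r (tgt e)) (hK : ∀ v, r v < K) :
    edgeMatrix src tgt w S ^ K = 0 := by
  ext u v
  exact edgeMatrix_pow_apply_eq_zero hr K (by have := hK v; omega)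

theorem pathMatrix_apply_eq_zero (hr : ∀ e ∈ S, r (src e) < r (tgt e)) {u v : V}
    (h : r v < r u) : pathMatrix src tgt w K S u v = 0 := by
  rw [pathMatrix, Matrix.sum_apply]
  exact Finset.sum_eq_zero fun k _ => edgeMatrix_pow_apply_eq_zero hr k (by omega)

/-- The effect on path sums of adding one edge to an acyclic graph. -/
theorem pathMatrix_insert_apply {e : E} (he : e ∉ S)
    (hr : ∀ e' ∈ insert e S, r (src e') < r (tgt e')) (hK : ∀ v, r v < K) (x y : V) :
    pathMatrix src tgt w K (insert e S) x y = pathMatrix src tgt w K S x y +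
      pathMatrix src tgt w K S x (src e) * w e * pathMatrix src tgt w K S (tgt e) y := by
  have hrS : ∀ e' ∈ S, r (src e') < r (tgt e') := fun e' h => hr e' (Finset.mem_insert_of_mem h)
  set N := pathMatrix src tgt w K S with hN
  set N' := pathMatrix src tgt w K (insert e S) with hN'
  -- By nilpotency, path matrices invert `1 - edgeMatrix`; `h4` is the resulting resolvent identity.
  have h1 : N * (1 - edgeMatrix src tgt w S) = 1 := by
    rw [hN, pathMatrix, geom_sum_mul_neg, edgeMatrix_pow_eq_zero hrS hK, sub_zero]
  have h2 : (1 - edgeMatrix src tgt w (insert e S)) * N' = 1 := by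
    rw [hN', pathMatrix, mul_neg_geom_sum, edgeMatrix_pow_eq_zero hr hK, sub_zero]
  have h3 : edgeMatrix src tgt w (insert e S) =
      Matrix.single (src e) (tgt e) (w e) + edgeMatrix src tgt w S := by
    rw [edgeMatrix, Finset.sum_insert he, edgeMatrix]
  have h4 : N' = N + N * (Matrix.single (src e) (tgt e) (w e) * N') := by
    calc N' = N * (1 - edgeMatrix src tgt w S) * N' := by rw [h1, one_mul]
      _ = N * ((1 - edgeMatrix src tgt w (insert e S)) * N') +
          N * (Matrix.single (src e) (tgt e) (w e) * N') := by
        rw [h3]; noncomm_ring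
      _ = _ := by rw [h2, mul_one]
  have h5 (x y : V) : N' x y = N x y + N x (src e) * w e * N' (tgt e) y := by
    conv_lhs => rw [h4]
    rw [Matrix.add_apply, Matrix.mul_apply, Finset.sum_eq_single (src e)]
    · rw [Matrix.single_mul_apply_same, mul_assoc]
    · intro z _ hz
      rw [Matrix.single_mul_apply_of_ne _ _ _ _ _ hz, mul_zero]
    · simp
  -- No path leads from the head of `e` back to its tail, so `e` is used at most once.
  have h6 : N (tgt e) (src e) = 0 :=
    pathMatrix_apply_eq_zero hrS (hr e (Finset.mem_insert_self _ _))
  rw [h5 x y, h5 (tgt e) y, h6]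
  ring

end PathSum

/-! ### Peeling off edges at the cost of one product each. -/

section PathForm

open MvPolynomial
open scoped Classical

variable {V E F σ : Type*} [Fintype V] [Field F] {src tgt : E → V}
  {w : E → MvPolynomial σ F} {S : Finset E} {r : V → ℕ} {K Δ : ℕ}

/-- The weighted sum over paths with scalar initial weights `a` and final weights `b`. -/
noncomputable def pathForm (src tgt : E → V) (w : E → MvPolynomial σ F) (K : ℕ) (S : Finset E)
    (a : V → F) (b : V → MvPolynomial σ F) : MvPolynomial σ F :=
  ∑ x, ∑ y, C (a x) * pathMatrix src tgt w K S x y * b y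

theorem pathForm_add_add (a a' : V → F) (b b' : V → MvPolynomial σ F) :
    pathForm src tgt w K S (a + a') (b + b') =
      pathForm src tgt w K S a b + pathForm src tgt w K S a b' +
        pathForm src tgt w K S a' b + pathForm src tgt w K S a' b' := by
  simp only [pathForm, ← Finset.sum_add_distrib]
  refine Finset.sum_congr rfl fun x _ => Finset.sum_congr rfl fun y _ => ?_
  rw [Pi.add_apply, Pi.add_apply, map_add]
  ring

theorem pathForm_single_left (v : V) (α : F) (b : V → MvPolynomial σ F) :
    pathForm src tgt w K S (Pi.single v α) b =
      C α * ∑ y, pathMatrix src tgt w K S v y * b y := by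
  rw [pathForm, Finset.sum_eq_single v, Finset.mul_sum]
  · refine Finset.sum_congr rfl fun y _ => ?_
    rw [Pi.single_eq_same, mul_assoc]
  · intro x _ hx
    simp [Pi.single_eq_of_ne hx]
  · simp

theorem pathForm_single_right (u : V) (a : V → F) (c : MvPolynomial σ F) :
    pathForm src tgt w K S a (Pi.single u c) =
      (∑ x, C (a x) * pathMatrix src tgt w K S x u) * c := by
  rw [pathForm, Finset.sum_mul]
  refine Finset.sum_congr rfl fun x _ => ?_
  rw [Finset.sum_eq_single u, Pi.single_eq_same]
  · intro y _ hy
    rw [Pi.single_eq_of_ne hy, mul_zero]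
  · simp

theorem totalDegree_edgeMatrix_pow_apply_le (hw : ∀ e ∈ S, (w e).totalDegree ≤ Δ) (k : ℕ)
    (u v : V) : ((edgeMatrix src tgt w S ^ k) u v).totalDegree ≤ k * Δ := by
  induction k generalizing u with
  | zero =>
    rw [pow_zero, Matrix.one_apply]
    split_ifs <;> simp
  | succ k ih =>
    rw [edgeMatrix_pow_succ_apply]
    refine totalDegree_finsetSum_le fun e he => ?_
    split_ifs
    · refine (totalDegree_mul _ _).trans ?_
      have h1 := hw e he
      have h2 := ih (tgt e)
      rw [add_mul, one_mul]
      omega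
    · simp

/-- Powers beyond `D` vanish, so the bound does not depend on `K`; thus `K` can be fixed by the full
graph and `D` by the sparser one. -/
theorem totalDegree_pathMatrix_apply_le {D : ℕ} (hr : ∀ e ∈ S, r (src e) < r (tgt e))
    (hD : ∀ v, r v ≤ D) (hw : ∀ e ∈ S, (w e).totalDegree ≤ Δ) (u v : V) :
    (pathMatrix src tgt w K S u v).totalDegree ≤ D * Δ := by
  rw [pathMatrix, Matrix.sum_apply]
  refine totalDegree_finsetSum_le fun k _ => ?_
  by_cases hk : k ≤ D
  · exact (totalDegree_edgeMatrix_pow_apply_le hw k u v).trans (Nat.mul_le_mul_right _ hk)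
  · rw [edgeMatrix_pow_apply_eq_zero hr k (by have := hD v; omega)]
    simp

theorem totalDegree_pathForm_le {D : ℕ} (hr : ∀ e ∈ S, r (src e) < r (tgt e))
    (hD : ∀ v, r v ≤ D) (hw : ∀ e ∈ S, (w e).totalDegree ≤ Δ) (a : V → F)
    {b : V → MvPolynomial σ F} (hb : ∀ v, (b v).totalDegree ≤ Δ) :
    (pathForm src tgt w K S a b).totalDegree ≤ (D + 1) * Δ := by
  refine totalDegree_finsetSum_le fun x _ => totalDegree_finsetSum_le fun y _ => ?_
  refine (totalDegree_mul _ _).trans ?_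
  have h1 := totalDegree_mul (C (a x)) (pathMatrix src tgt w K S x y)
  have h2 := totalDegree_pathMatrix_apply_le (K := K) hr hD hw x y
  have h3 := hb y
  rw [totalDegree_C] at h1
  rw [add_mul, one_mul]
  omega

/-- Paths through `e` contribute `P₀ * Q₀ = (P₀ - α) * (Q₀ - β) + α * Q₀ + β * P₀ - α * β`. The
linear terms are absorbed into the boundary weights: `α * Q₀` starts at the head of `e`, and `β *
P₀` ends at its tail with final weight `β * w e`. This is why final weights are polynomials of
degree at most `Δ`. -/
theorem pathForm_insert {e : E} (he : e ∉ S)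
    (hr : ∀ e' ∈ insert e S, r (src e') < r (tgt e')) (hK : ∀ v, r v < K)
    (hw : (w e).totalDegree ≤ Δ) (a : V → F) {b : V → MvPolynomial σ F}
    (hb : ∀ v, (b v).totalDegree ≤ Δ) :
    ∃ (P Q : MvPolynomial σ F) (c : F) (a' : V → F) (b' : V → MvPolynomial σ F),
      constantCoeff P = 0 ∧ constantCoeff Q = 0 ∧ (∀ v, (b' v).totalDegree ≤ Δ) ∧
      pathForm src tgt w K (insert e S) a b = P * Q + C c + pathForm src tgt w K S a' b' := by
  have hrS : ∀ e' ∈ S, r (src e') < r (tgt e') := fun e' h => hr e' (Finset.mem_insert_of_mem h)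
  set N := pathMatrix src tgt w K S with hN
  set P₀ := (∑ x, C (a x) * N x (src e)) * w e with hP₀
  set Q₀ := ∑ y, N (tgt e) y * b y with hQ₀
  set α := constantCoeff P₀
  set β := constantCoeff Q₀
  have hback : N (tgt e) (src e) = 0 :=
    pathMatrix_apply_eq_zero hrS (hr e (Finset.mem_insert_self _ _))
  refine ⟨P₀ - C α, Q₀ - C β, -(α * β), a + Pi.single (tgt e) α,
    b + Pi.single (src e) (C β * w e), by simp [α], by simp [β], fun v => ?_, ?_⟩
  · refine (totalDegree_add _ _).trans (max_le (hb v) ?_)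
    by_cases hv : v = src e
    · subst hv
      rw [Pi.single_eq_same]
      refine (totalDegree_mul _ _).trans ?_
      rw [totalDegree_C]
      omega
    · rw [Pi.single_eq_of_ne hv]
      simp
  · have h1 : pathForm src tgt w K (insert e S) a b = pathForm src tgt w K S a b + P₀ * Q₀ := by
      simp only [pathForm, pathMatrix_insert_apply he hr hK, hP₀, hQ₀, ← hN]
      rw [Finset.sum_mul, Finset.sum_mul_sum, ← Finset.sum_add_distrib]
      refine Finset.sum_congr rfl fun x _ => ?_
      rw [← Finset.sum_add_distrib]
      refine Finset.sum_congr rfl fun y _ => ?_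
      ring
    have h2 : pathForm src tgt w K S (a + Pi.single (tgt e) α)
        (b + Pi.single (src e) (C β * w e)) =
        pathForm src tgt w K S a b + C α * Q₀ + C β * P₀ := by
      -- The cross term of the two new boundary weights vanishes by acyclicity.
      have h3 : ∑ y, N (tgt e) y * (Pi.single (src e) (C β * w e) : V → MvPolynomial σ F) y = 0 := by
        rw [Finset.sum_eq_single (src e), hback, zero_mul]
        · intro y _ hy
          rw [Pi.single_eq_of_ne hy, mul_zero]
        · simp
      rw [pathForm_add_add, pathForm_single_left, pathForm_single_right, pathForm_single_left,
        ← hN, ← hQ₀, h3, hP₀]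
      ring
    rw [h1, h2]
    simp only [map_neg, map_mul]
    ring

theorem pathForm_union (T : Finset E) (hST : Disjoint S T)
    (hr : ∀ e, r (src e) < r (tgt e)) (hK : ∀ v, r v < K)
    (hw : ∀ e, (w e).totalDegree ≤ Δ) (a : V → F) (b : V → MvPolynomial σ F)
    (hb : ∀ v, (b v).totalDegree ≤ Δ) :
    ∃ (P Q : E → MvPolynomial σ F) (c : F) (a' : V → F) (b' : V → MvPolynomial σ F),
      (∀ j ∈ T, constantCoeff (P j) = 0) ∧ (∀ j ∈ T, constantCoeff (Q j) = 0) ∧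
      (∀ v, (b' v).totalDegree ≤ Δ) ∧
      pathForm src tgt w K (T ∪ S) a b =
        ∑ j ∈ T, P j * Q j + C c + pathForm src tgt w K S a' b' := by
  induction T using Finset.induction_on generalizing a b with
  | empty => exact ⟨0, 0, 0, a, b, by simp, by simp, hb, by simp⟩
  | insert e T heT ih =>
    rw [Finset.disjoint_insert_right] at hST
    have he : e ∉ T ∪ S := by
      rw [Finset.mem_union, not_or]; exact ⟨heT, hST.1⟩
    obtain ⟨p, q, c, a', b', hp, hq, hb', h⟩ := pathForm_insert (w := w) he
      (fun e' _ => hr e') hK (hw e) a hb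
    obtain ⟨P, Q, c', a'', b'', hP, hQ, hb'', h'⟩ := ih hST.2 a' b' hb'
    have hne : ∀ j ∈ T, j ≠ e := fun j hj hje => heT (hje ▸ hj)
    refine ⟨Function.update P e p, Function.update Q e q, c + c', a'', b'', ?_, ?_, hb'', ?_⟩
    · intro j hj
      rcases Finset.mem_insert.1 hj with rfl | hj
      · simpa using hp
      · rw [Function.update_of_ne (hne j hj)]; exact hP j hj
    · intro j hj
      rcases Finset.mem_insert.1 hj with rfl | hj
      · simpa using hq
      · rw [Function.update_of_ne (hne j hj)]; exact hQ j hj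
    · have hinsert : insert e (T ∪ S) = insert e T ∪ S := by rw [Finset.insert_union]
      have hsum : ∑ j ∈ T, Function.update P e p j * Function.update Q e q j =
          ∑ j ∈ T, P j * Q j := Finset.sum_congr rfl fun j hj => by
        rw [Function.update_of_ne (hne j hj), Function.update_of_ne (hne j hj)]
      rw [Finset.sum_insert heT, hsum, Function.update_self, Function.update_self, map_add]
      rw [← hinsert, h, h']
      ring

end PathForm

/-! ### Depth reduction by binary digits. -/

/-- Pairs of numbers below `2 ^ k` are sorted into `k` classes by their first differing binary
digit; forgetting the digits in a set `T` preserves the order of pairs in the other classes. -/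
theorem exists_digit_classes (k : ℕ) :
    ∃ cl : ℕ → ℕ → ℕ, (∀ a b, a < b → b < 2 ^ k → cl a b < k) ∧
      ∀ T ⊆ Finset.range k, ∃ φ : ℕ → ℕ, (∀ a, a < 2 ^ k → φ a < 2 ^ (k - T.card)) ∧
        ∀ a b, a < b → b < 2 ^ k → cl a b ∉ T → φ a < φ b := by
  induction k with
  | zero =>
    refine ⟨fun _ _ => 0, fun a b hab hb => by simp at hb; omega, fun T hT => ⟨fun _ => 0, ?_, ?_⟩⟩
    · intro a _; positivity
    · intro a b hab hb; simp at hb; omega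
  | succ k ih =>
    obtain ⟨cl, hcl, hφ⟩ := ih
    have hlt {a b : ℕ} (hab : a < b) (h : a / 2 ≠ b / 2) : a / 2 < b / 2 := by omega
    have hdiv {b : ℕ} (hb : b < 2 ^ (k + 1)) : b / 2 < 2 ^ k := by rw [pow_succ] at hb; omega
    -- Class `k` holds the pairs differing only in the last digit; `φ` below drops that digit if `k
    -- ∈ T` and keeps it otherwise.
    refine ⟨fun a b => if a / 2 = b / 2 then k else cl (a / 2) (b / 2), fun a b hab hb => ?_,
      fun T hT => ?_⟩
    · dsimp only
      split_ifs with h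
      · omega
      · exact (hcl _ _ (hlt hab h) (hdiv hb)).trans (Nat.lt_succ_self k)
    have hT' : T.erase k ⊆ Finset.range k := fun i hi => by
      have h1 := Finset.mem_range.1 (hT (Finset.mem_of_mem_erase hi))
      have h2 := Finset.ne_of_mem_erase hi
      exact Finset.mem_range.2 (by omega)
    have hcard := Finset.card_le_card hT'
    rw [Finset.card_range] at hcard
    obtain ⟨φ, hφ1, hφ2⟩ := hφ _ hT'
    have hnot {a b : ℕ} (hab : a < b) (hb : b < 2 ^ (k + 1)) (h : a / 2 ≠ b / 2)
        (hc : cl (a / 2) (b / 2) ∉ T) : φ (a / 2) < φ (b / 2) :=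
      hφ2 _ _ (hlt hab h) (hdiv hb) fun hm => hc (Finset.mem_of_mem_erase hm)
    by_cases hk : k ∈ T
    · refine ⟨fun a => φ (a / 2), fun a ha => ?_, fun a b hab hb hc => ?_⟩
      · have := hφ1 _ (hdiv ha)
        rw [Finset.card_erase_of_mem hk] at this
        have hpos := Finset.card_pos.2 ⟨k, hk⟩
        rwa [show k - (T.card - 1) = k + 1 - T.card by omega] at this
      · dsimp only at hc
        split_ifs at hc with h
        · exact absurd hk hc
        · exact hnot hab hb h hc
    · refine ⟨fun a => 2 * φ (a / 2) + a % 2, fun a ha => ?_, fun a b hab hb hc => ?_⟩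
      · have := hφ1 _ (hdiv ha)
        rw [Finset.erase_eq_of_notMem hk] at this hcard
        rw [show k + 1 - T.card = k - T.card + 1 by omega, pow_succ]
        dsimp only
        omega
      · dsimp only at hc ⊢
        split_ifs at hc with h
        · rw [h]; omega
        · have := hnot hab hb h hc
          omega

/-- Among `k` numbers, some `t` have at most a proportion `t / k` of the total. -/
theorem exists_subset_mul_sum_le {ι : Type*} (s : Finset ι) (f : ι → ℕ) {t : ℕ}
    (ht : t ≤ s.card) :
    ∃ T ⊆ s, T.card = t ∧ s.card * ∑ i ∈ T, f i ≤ t * ∑ i ∈ s, f i := by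
  classical
  induction ht using Nat.decreasingInduction with
  | self => exact ⟨s, subset_rfl, rfl, le_rfl⟩
  | of_succ t ht ih =>
    obtain ⟨T, hTs, hT, hsum⟩ := ih
    -- Discarding a largest element does not increase the average.
    obtain ⟨m, hm, hmax⟩ := T.exists_max_image f (Finset.card_pos.1 (by omega))
    refine ⟨T.erase m, (Finset.erase_subset _ _).trans hTs, by
      rw [Finset.card_erase_of_mem hm, hT]; rfl, ?_⟩
    have h1 := Finset.add_sum_erase T f hm
    have h2 : ∑ i ∈ T, f i ≤ (t + 1) * f m := by
      have := Finset.sum_le_card_nsmul T f (f m) hmax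
      rwa [hT, smul_eq_mul] at this
    have h3 : (t + 1) * ∑ i ∈ T.erase m, f i ≤ t * ∑ i ∈ T, f i := by nlinarith
    refine le_of_mul_le_mul_left ?_ (Nat.succ_pos t)
    calc (t + 1) * (s.card * ∑ i ∈ T.erase m, f i)
        = s.card * ((t + 1) * ∑ i ∈ T.erase m, f i) := by ring
      _ ≤ s.card * (t * ∑ i ∈ T, f i) := Nat.mul_le_mul_left _ h3
      _ = t * (s.card * ∑ i ∈ T, f i) := by ring
      _ ≤ t * ((t + 1) * ∑ i ∈ s, f i) := Nat.mul_le_mul_left _ hsum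
      _ = (t + 1) * (t * ∑ i ∈ s, f i) := by ring

/-- Depth reduction: in a graph whose vertices are ranked below `2 ^ k`, removing a proportion of
at most `t / k` of the edges leaves a graph with a ranking below `2 ^ (k - t)`. -/
theorem exists_edge_removal {V E : Type*} [Fintype E] (src tgt : E → V) (r : V → ℕ)
    (hr : ∀ e, r (src e) < r (tgt e)) {k t : ℕ} (hk : ∀ v, r v < 2 ^ k) (ht : t ≤ k) :
    ∃ (T : Finset E) (ρ : V → ℕ), k * T.card ≤ t * Fintype.card E ∧
      (∀ v, ρ v < 2 ^ (k - t)) ∧ ∀ e ∉ T, ρ (src e) < ρ (tgt e) := by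
  classical
  obtain ⟨cl, hcl, hφ⟩ := exists_digit_classes k
  let g : E → ℕ := fun e => cl (r (src e)) (r (tgt e))
  have hg (e : E) : g e ∈ Finset.range k := Finset.mem_range.2 (hcl _ _ (hr e) (hk _))
  obtain ⟨B, hB, hBt, hsum⟩ := exists_subset_mul_sum_le (Finset.range k)
    (fun i => (Finset.univ.filter fun e => g e = i).card) (t := t) (by simpa using ht)
  obtain ⟨φ, hφ1, hφ2⟩ := hφ B hB
  rw [hBt] at hφ1
  refine ⟨Finset.univ.filter fun e => g e ∈ B, fun v => φ (r v), ?_, fun v => hφ1 _ (hk v),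
    fun e he => hφ2 _ _ (hr e) (hk _) (by simpa using he)⟩
  rw [Finset.card_range] at hsum
  have h1 := Finset.card_eq_sum_card_fiberwise (s := Finset.univ) (f := g) (t := Finset.range k)
    (fun e _ => Finset.mem_coe.2 (hg e))
  have h2 := Finset.card_eq_sum_card_fiberwise (s := Finset.univ.filter fun e => g e ∈ B) (f := g)
    (t := B) (fun e he => by simpa using he)
  rw [Finset.card_univ] at h1
  rw [h1, h2]
  refine le_of_eq_of_le ?_ hsum
  congr 1
  refine Finset.sum_congr rfl fun i hi => ?_
  congr 1
  ext e
  simp only [Finset.mem_filter, Finset.mem_univ, true_and, and_iff_right_iff_imp]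
  rintro rfl
  exact hi

/-! ### Matrix powers as sums over edge lists. -/

section Walks

open scoped Classical

/-- Prepending an element to a list, as an embedding of pairs. -/
def consEmbedding (E : Type*) : E × List E ↪ List E where
  toFun p := p.1 :: p.2
  inj' _ _ h := Prod.ext (List.cons.inj h).1 (List.cons.inj h).2

theorem consEmbedding_apply {E : Type*} (e : E) (l : List E) :
    consEmbedding E (e, l) = e :: l := rfl

/-- The lists of edges of length `k`. -/
noncomputable def edgeLists (E : Type*) [Fintype E] : ℕ → Finset (List E)
  | 0 => {[]}
  | k + 1 => (Finset.univ ×ˢ edgeLists E k).map (consEmbedding E)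

theorem mem_edgeLists {E : Type*} [Fintype E] {k : ℕ} {l : List E} :
    l ∈ edgeLists E k ↔ l.length = k := by
  induction k generalizing l with
  | zero => simp [edgeLists]
  | succ k ih =>
    cases l with
    | nil => simp [edgeLists, consEmbedding_apply]
    | cons e l => simp [edgeLists, consEmbedding_apply, ih]

theorem edgeMatrix_univ_pow_apply {V E R : Type*} [Fintype V] [Fintype E] [CommRing R]
    (src tgt : E → V) (w : E → R) (k : ℕ) (u v : V) :
    (edgeMatrix src tgt w Finset.univ ^ k) u v =
      ∑ l ∈ edgeLists E k, if IsDiPath src tgt u l v then (l.map w).prod else 0 := by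
  induction k generalizing u with
  | zero => simp [edgeLists, Matrix.one_apply, IsDiPath]
  | succ k ih =>
    rw [edgeMatrix_pow_succ_apply, edgeLists, Finset.sum_map, Finset.sum_product]
    refine Finset.sum_congr rfl fun e _ => ?_
    rw [ih, Finset.mul_sum]
    by_cases hu : src e = u <;> simp [hu, IsDiPath, consEmbedding_apply]

end Walks

/-! ### Application to branching programs. -/

namespace UnlayeredABP

variable {F : Type*} [Field F] {n : ℕ} {V E : Type*}

theorem length_le_card [Fintype E] (A : UnlayeredABP F n V E) {l : List E} {u v : V}
    (h : IsDiPath A.src A.tgt u l v) : l.length ≤ Fintype.card E :=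
  (A.nodup_of_isDiPath h).length_le_card

theorem exists_ranking [Fintype E] (A : UnlayeredABP F n V E) :
    ∃ r : V → ℕ, (∀ v, r v ≤ Fintype.card E) ∧ ∀ e, r (A.src e) < r (A.tgt e) := by
  classical
  let p (v : V) (k : ℕ) : Prop := ∃ l w, IsDiPath A.src A.tgt v l w ∧ l.length = k
  -- The length of a longest path leaving `v`; it drops along every edge, so its complement in
  -- `Fintype.card E` is a ranking.
  let h (v : V) : ℕ := Nat.findGreatest (p v) (Fintype.card E)
  have key (e : E) : h (A.tgt e) + 1 ≤ h (A.src e) := by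
    obtain ⟨l, w, hl, hlen⟩ : p (A.tgt e) (h (A.tgt e)) :=
      Nat.findGreatest_spec (Nat.zero_le _) ⟨[], A.tgt e, rfl, rfl⟩
    have hpath : IsDiPath A.src A.tgt (A.src e) (e :: l) w := ⟨rfl, hl⟩
    have hle := A.length_le_card hpath
    rw [List.length_cons, hlen] at hle
    exact Nat.le_findGreatest hle ⟨e :: l, w, hpath, by rw [List.length_cons, hlen]⟩
  have hle (v : V) : h v ≤ Fintype.card E := Nat.findGreatest_le _
  refine ⟨fun v => Fintype.card E - h v, fun v => Nat.sub_le _ _, fun e => ?_⟩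
  have h1 := key e
  have h2 := hle (A.src e)
  dsimp only
  omega

theorem computedPolynomial_eq_pathMatrix [Fintype V] [Fintype E] (A : UnlayeredABP F n V E) :
    A.computedPolynomial =
      pathMatrix A.src A.tgt A.label (Fintype.card E + 1) Finset.univ A.start A.finish := by
  classical
  have hset : {l : List E | A.IsComputationPath l} =
      ↑(((Finset.range (Fintype.card E + 1)).biUnion (edgeLists E)).filter
        A.IsComputationPath) := by
    ext l
    simp only [Set.mem_ofPred_eq, Finset.coe_filter, Finset.mem_biUnion, Finset.mem_range,
      mem_edgeLists]
    exact ⟨fun h => ⟨⟨l.length, Nat.lt_succ_of_le (A.length_le_card h), rfl⟩, h⟩, fun h => h.2⟩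
  rw [computedPolynomial, hset, finsum_mem_coe_finset, Finset.sum_filter, Finset.sum_biUnion,
    pathMatrix, Matrix.sum_apply]
  · refine Finset.sum_congr rfl fun k _ => ?_
    rw [edgeMatrix_univ_pow_apply]
    exact Finset.sum_congr rfl fun l _ => if_congr Iff.rfl rfl rfl
  · intro i _ j _ hij
    refine Finset.disjoint_left.2 fun l hi hj => hij ?_
    rw [mem_edgeLists] at hi hj
    rw [← hi, ← hj]

open MvPolynomial in
/-- A set of edges of an unlayered program computing a power sum has at least `n / 2` elements, if
its removal leaves only short paths. -/
theorem le_two_mul_card_of_removal [Fintype V] [Fintype E] (A : UnlayeredABP F n V E) {Δ D : ℕ}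
    (hn : (n : F) ≠ 0) (hΔ : A.LabelsDegreeLE Δ)
    (hA : A.computedPolynomial = ∑ i : Fin n, X i ^ n) (T : Finset E) (ρ : V → ℕ)
    (hρ : ∀ v, ρ v ≤ D) (hT : ∀ e ∉ T, ρ (A.src e) < ρ (A.tgt e)) (hD : (D + 1) * Δ < n) :
    n ≤ 2 * T.card := by
  classical
  obtain ⟨r, hrle, hr⟩ := A.exists_ranking
  have hdeg (v : V) : ((Pi.single A.finish 1 : V → MvPolynomial (Fin n) F) v).totalDegree ≤ Δ := by
    rw [Pi.single_apply]
    split_ifs <;> simp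
  -- The ranking `r` of the whole graph justifies the peeling; `ρ` serves only to bound the degree
  -- of what remains.
  obtain ⟨P, Q, c, a, b, hP, hQ, hb, h⟩ := pathForm_union (w := A.label) (S := Tᶜ) T
    disjoint_compl_left hr (fun v => Nat.lt_succ_of_le (hrle v)) hΔ (Pi.single A.start 1)
    (Pi.single A.finish 1) hdeg
  have hS : ∀ e ∈ Tᶜ, ρ (A.src e) < ρ (A.tgt e) := fun e he => hT e (Finset.mem_compl.1 he)
  have hR := totalDegree_pathForm_le (K := Fintype.card E + 1) hS hρ
    (fun e _ => hΔ e) a hb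
  refine le_two_mul_card_of_sum_pow_eq T P Q
    (C c + pathForm A.src A.tgt A.label (Fintype.card E + 1) Tᶜ a b) hn hP hQ ?_ ?_
  · refine (totalDegree_add _ _).trans_lt (max_lt ?_ (hR.trans_lt hD))
    rw [totalDegree_C]
    omega
  · have hTS : T ∪ Tᶜ = Finset.univ := by
      ext e
      simp
    rw [hTS, pathForm_single_left, Finset.sum_eq_single A.finish
      (fun y _ hy => by rw [Pi.single_eq_of_ne hy, mul_zero]) (by simp), Pi.single_eq_same,
      mul_one, map_one, one_mul] at h
    rw [← add_assoc, ← hA, computedPolynomial_eq_pathMatrix]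
    exact h

/-- The number of edges of an unlayered program computing a power sum is at least `n k / (2 t)`
if it is less than `2 ^ k` and `2 ^ (k - t)` times the degree of the labels is less than `n`. -/
theorem mul_le_two_mul_mul_card [Fintype V] [Fintype E] (A : UnlayeredABP F n V E) {Δ k t : ℕ}
    (hn : (n : F) ≠ 0) (hΔ : A.LabelsDegreeLE Δ)
    (hA : A.computedPolynomial = ∑ i : Fin n, MvPolynomial.X i ^ n)
    (hk : Fintype.card E < 2 ^ k) (ht : t ≤ k) (hD : 2 ^ (k - t) * Δ < n) :
    n * k ≤ 2 * t * Fintype.card E := by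
  obtain ⟨r, hrle, hr⟩ := A.exists_ranking
  obtain ⟨T, ρ, hT, hρ, hlt⟩ := exists_edge_removal A.src A.tgt r hr
    (fun v => (hrle v).trans_lt hk) ht
  have hpos : 0 < 2 ^ (k - t) := by positivity
  have := A.le_two_mul_card_of_removal hn hΔ hA T ρ (D := 2 ^ (k - t) - 1)
    (fun v => Nat.le_sub_one_of_lt (hρ v)) hlt (by rwa [Nat.sub_add_cancel hpos])
  calc n * k ≤ 2 * T.card * k := Nat.mul_le_mul_right _ this
    _ = 2 * (k * T.card) := by ring
    _ ≤ 2 * (t * Fintype.card E) := Nat.mul_le_mul_left _ hT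
    _ = _ := by ring

end UnlayeredABP

/-! ### Choice of parameters and asymptotics. -/

theorem IsSubpolynomial.eventually_le_rpow_half {Δ : ℕ → ℕ} (h : IsSubpolynomial Δ) :
    ∀ᶠ n : ℕ in atTop, (Δ n : ℝ) ≤ (n : ℝ) ^ (1 / 2 : ℝ) := by
  obtain ⟨ε, hε, hΔ⟩ := h
  filter_upwards [hΔ, hε.eventually_le_const (show (0 : ℝ) < 1 / 2 by norm_num),
    eventually_ge_atTop 1] with n h1 h2 h3
  exact h1.trans (Real.rpow_le_rpow_of_exponent_le (by exact_mod_cast h3) h2)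

theorem UnlayeredABP.quarter_mul_div_le_card {F : Type*} [Field F] {n : ℕ} {V E : Type*}
    [Fintype V] [Fintype E] (A : UnlayeredABP F n V E) {δ : ℕ} (hn : (n : F) ≠ 0)
    (hn16 : 16 ≤ n) (hδ : 1 ≤ δ) (hδn : (δ : ℝ) ≤ (n : ℝ) ^ (1 / 2 : ℝ)) (hA : A.LabelsDegreeLE δ)
    (hcomp : A.computedPolynomial = ∑ i : Fin n, MvPolynomial.X i ^ n) :
    1 / 4 * ((n : ℝ) * Real.logb 2 n / (Real.logb 2 (Real.logb 2 n) + Real.logb 2 δ)) ≤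
      Fintype.card E := by
  set m := Fintype.card E
  set L := Real.logb 2 n with hL
  set LL := Real.logb 2 L with hLL
  set ld := Real.logb 2 δ with hld
  have hn16' : (16 : ℝ) ≤ n := by exact_mod_cast hn16
  have hn0 : (0 : ℝ) < n := by linarith
  have hδ0 : (0 : ℝ) < δ := by exact_mod_cast hδ
  have hL4 : 4 ≤ L := by
    rw [hL, Real.le_logb_iff_rpow_le (by norm_num) hn0]
    norm_num
    exact hn16
  have hLL2 : 2 ≤ LL := by
    rw [hLL, Real.le_logb_iff_rpow_le (by norm_num) (by linarith)]
    norm_num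
    exact hL4
  have hld0 : 0 ≤ ld := Real.logb_nonneg (by norm_num) (by exact_mod_cast hδ)
  have hldL : ld ≤ 1 / 2 * L := by
    rw [hld, hL, ← Real.logb_rpow_eq_mul_logb_of_pos hn0]
    exact Real.logb_le_logb_of_le (by norm_num) hδ0 hδn
  have hnL : (2 : ℝ) ^ L = n := Real.rpow_logb (by norm_num) (by norm_num) hn0
  have hLpow : (2 : ℝ) ^ LL = L := Real.rpow_logb (by norm_num) (by norm_num) (by linarith)
  have hδpow : (2 : ℝ) ^ ld = δ := Real.rpow_logb (by norm_num) (by norm_num) hδ0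
  have hden : 0 < LL + ld := by linarith
  have hnLpos : 0 < (n : ℝ) * L := by positivity
  -- A program with at least `n * L` edges satisfies the bound already, since `LL + ld ≥ 1`.
  by_cases hm : (n : ℝ) * L ≤ m
  · refine le_trans ?_ hm
    have : (n : ℝ) * L / (LL + ld) ≤ n * L := div_le_self hnLpos.le (by linarith)
    linarith
  rw [not_le] at hm
  -- These give `2 ^ k ≥ n * L > m` and `k - t < L - ld`, so `2 ^ (k - t) * δ < n`. The bound `δ ≤
  -- √n` ensures `t ≤ k`.
  set k := ⌈L + LL⌉₊ with hk
  set t := ⌈LL + ld + 1⌉₊ with ht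
  have hk1 : L + LL ≤ k := Nat.le_ceil _
  have hk2 : (k : ℝ) < L + LL + 1 := Nat.ceil_lt_add_one (by linarith)
  have ht1 : LL + ld + 1 ≤ t := Nat.le_ceil _
  have ht2 : (t : ℝ) < LL + ld + 1 + 1 := Nat.ceil_lt_add_one (by linarith)
  have htk : t ≤ k := Nat.ceil_mono (by linarith)
  have hmk : m < 2 ^ k := by
    have : (m : ℝ) < 2 ^ k := by
      refine hm.trans_le ?_
      calc (n : ℝ) * L = 2 ^ (L + LL) := by rw [Real.rpow_add (by norm_num), hnL, hLpow]
        _ ≤ (2 : ℝ) ^ (k : ℝ) := Real.rpow_le_rpow_of_exponent_le (by norm_num) hk1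
        _ = 2 ^ k := Real.rpow_natCast _ _
    exact_mod_cast this
  have hD : 2 ^ (k - t) * δ < n := by
    have : (2 : ℝ) ^ (k - t) * δ < n := by
      calc (2 : ℝ) ^ (k - t) * δ = 2 ^ ((k : ℝ) - t + ld) := by
            rw [Real.rpow_add (by norm_num), hδpow, ← Nat.cast_sub htk, Real.rpow_natCast]
        _ < (2 : ℝ) ^ L := Real.rpow_lt_rpow_of_exponent_lt (by norm_num) (by linarith)
        _ = n := hnL
    exact_mod_cast this
  have hmain : (n : ℝ) * k ≤ 2 * t * m := by
    exact_mod_cast A.mul_le_two_mul_mul_card hn hA hcomp hmk htk hD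
  have hm0 : (0 : ℝ) ≤ m := Nat.cast_nonneg _
  have h1 : (n : ℝ) * L ≤ n * k := mul_le_mul_of_nonneg_left (by linarith) hn0.le
  -- `t < LL + ld + 2 ≤ 2 * (LL + ld)` because `LL ≥ 2`, which is where `16 ≤ n` enters.
  have h2 : 2 * (t : ℝ) * m ≤ 4 * (LL + ld) * m :=
    mul_le_mul_of_nonneg_right (by linarith) hm0
  have h3 : (n : ℝ) * L / (LL + ld) ≤ 4 * m := by
    rw [div_le_iff₀ hden]
    linarith
  linarith

theorem theorem1p2 :
    ∃ c : ℝ, 0 < c ∧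
      ∀ Δ : ℕ → ℕ, IsSubpolynomial Δ →
        ∃ N : ℕ, ∀ n : ℕ, N ≤ n →
          ∀ (F : Type*) [Field F], ¬ ringChar F ∣ n →
            ∀ (V E : Type*) [Finite V] [Finite E] (A : UnlayeredABP F n V E),
              A.LabelsDegreeLE (Δ n) →
              A.computedPolynomial = ∑ i : Fin n, (MvPolynomial.X i) ^ n →
                c * ((n : ℝ) * Real.logb 2 n /
                    (Real.logb 2 (Real.logb 2 n) + Real.logb 2 (Δ n))) ≤ (A.size : ℝ) := by
  refine ⟨1 / 4, by norm_num, fun Δ hΔ => ?_⟩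
  obtain ⟨N, hN⟩ := eventually_atTop.1 hΔ.eventually_le_rpow_half
  refine ⟨max N 16, fun n hn F _ hF V E _ _ A hA hcomp => ?_⟩
  have := Fintype.ofFinite V
  have := Fintype.ofFinite E
  have hn16 : 16 ≤ n := (le_max_right _ _).trans hn
  have hone : (1 : ℝ) ≤ (n : ℝ) ^ (1 / 2 : ℝ) :=
    Real.one_le_rpow (by exact_mod_cast (show 1 ≤ n by omega)) (by norm_num)
  -- With `Real.logb 2 0 = 0`, degree bound `0` can be replaced by `1`.
  have hlog : Real.logb 2 (Δ n) = Real.logb 2 (max (Δ n) 1 : ℕ) := by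
    rcases Nat.eq_zero_or_pos (Δ n) with h | h
    · simp [h]
    · rw [max_eq_left h]
  have hmax : ((max (Δ n) 1 : ℕ) : ℝ) ≤ (n : ℝ) ^ (1 / 2 : ℝ) := by
    push_cast
    exact max_le (hN n ((le_max_left _ _).trans hn)) hone
  rw [hlog, UnlayeredABP.size, Nat.card_eq_fintype_card]
  exact A.quarter_mul_div_le_card (fun h => hF ((ringChar.spec F n).1 h)) hn16
    (le_max_right _ _) hmax (fun e => (hA e).trans (le_max_left _ _)) hcomp
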